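/- Let $R>1$ be an integer and let $L\subset\mathbb{Z}$ be a complete set of representatives for $\mathbb{Z}/R\mathbb{Z}$ with $0\in L$. Put $B=\{0,1,\dots,R-1\}$, $m_B(x)=\frac1R\sum_{b\in B}e^{2\pi i bx}$ and $\sigma_l(x)=(x+l)/R$ for $x\in\mathbb{R}$, $l\in L$. An *$L$-cycle* is a set $\{x_0,\dots,x_{p-1}\}\subset\mathbb{R}$ with $p\ge1$ for which there are $l_0,\dots,l_{p-1}\in L$ with $\sigma_{l_i}(x_i)=x_{i+1}$ for $0\le i<p$, where $x_p:=x_0$. It is called *extreme* if $|m_B(x_i)|=1$ for all $i$. Define $$\Lambda_0=\bigcup\{-C: C\text{ is an extreme }L\text{-cycle}\},\qquad \Lambda_{n+1}=R\Lambda_n+L\quad(n\ge0);$$ these are finite sets of integers. Define the scrambled Dirichlet kernel and the partial sums of the scrambled Fourier series of $f$ by $$D_n(x)=\sum_{\lambda\in\Lambda_n}e^{2\pi i\lambda x},\qquad s_n(f;x)=\sum_{\lambda\in\Lambda_n}\Big(\int_0^1 f(y)e^{-2\pi i\lambda y}\,dy\Big)e^{2\pi i\lambda x}.$$ Let $p_L(z)=\sum_{l\in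 L}z^l$, with Mahler measure $\Delta(p_L)=\exp\Big(\int_0^1\log|p_L(e^{2\pi i x})|\,dx\Big)$. If $\Delta(p_L)>1$, then: (i) for every $\rho$ with $1<\rho<\Delta(p_L)$ there is a constant $C>0$ such that $\int_0^1|D_n(x)|\,dx\ge C\rho^n$ for all sufficiently large $n$; (ii) there is a continuous $1$-periodic function $f:\mathbb{R}\to\mathbb{C}$ such that the sequence $(s_n(f;0))_{n\ge0}$ is unbounded. -/

import Mathlib

open Filter LaurentPolynomial

namespace ScrambledFourier

/-- `L` is a complete set of representatives for `ℤ / Rℤ`. -/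
def IsCompleteResidueSystem (R : ℕ) (L : Finset ℤ) : Prop :=
  ∀ a : ℤ, ∃! l : ℤ, l ∈ L ∧ l ≡ a [ZMOD (R : ℤ)]

/-- The exponential `e_t(x) = exp(2πi t x)`. -/
noncomputable def e (t x : ℝ) : ℂ :=
  Complex.exp (2 * (Real.pi : ℂ) * Complex.I * (t : ℂ) * (x : ℂ))

/-- `m_B(x) = (1/#B) ∑_{b ∈ B} exp(2πi b x)`. -/
noncomputable def mask (B : Finset ℤ) (x : ℝ) : ℂ :=
  (1 / (B.card : ℂ)) * ∑ b ∈ B, e (b : ℝ) x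

/-- `σ_l(x) = (x + l) / R`. -/
noncomputable def branch (R : ℕ) (l : ℤ) (x : ℝ) : ℝ := (x + (l : ℝ)) / (R : ℝ)

/-- An `L`-cycle: a set `{x_0, …, x_{p-1}}` with `p ≥ 1` such that, for some
`l_0, …, l_{p-1} ∈ L`, the map `σ_{l_i}` takes `x_i` to `x_{i+1}` for all `i < p`, where
`x_p` means `x_0`. -/
def IsCycle (R : ℕ) (L : Finset ℤ) (C : Set ℝ) : Prop :=
  ∃ (p : ℕ) (x : ℕ → ℝ) (l : ℕ → ℤ), 0 < p ∧
    (∀ i < p, l i ∈ L ∧ branch R (l i) (x i) = x (i + 1)) ∧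
    x p = x 0 ∧ C = {y | ∃ i < p, x i = y}

/-- An extreme `L`-cycle (with respect to `B`): an `L`-cycle on which `|m_B| = 1`. -/
def IsExtremeCycle (R : ℕ) (B L : Finset ℤ) (C : Set ℝ) : Prop :=
  IsCycle R L C ∧ ∀ y ∈ C, ‖mask B y‖ = 1

/-- `Λ_0` is the union of the sets `-C` over all extreme `L`-cycles `C`, and
`Λ_{n+1} = R Λ_n + L`. -/
def freqSet (R : ℕ) (B L : Finset ℤ) : ℕ → Set ℝ
  | 0 => {y | ∃ C : Set ℝ, IsExtremeCycle R B L C ∧ -y ∈ C}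
  | n + 1 => {y | ∃ t ∈ freqSet R B L n, ∃ l ∈ L, y = (R : ℝ) * t + (l : ℝ)}

theorem norm_e (t x : ℝ) : ‖e t x‖ = 1 := by
  have h : 2 * (Real.pi : ℂ) * Complex.I * (t : ℂ) * (x : ℂ)
      = ((2 * Real.pi * t * x : ℝ) : ℂ) * Complex.I := by push_cast; ring
  rw [e, h, Complex.norm_exp_ofReal_mul_I]

theorem exists_int_of_norm_mask {B : Finset ℤ} (h0 : (0 : ℤ) ∈ B) (h1 : (1 : ℤ) ∈ B) {x : ℝ}
    (hx : ‖mask B x‖ = 1) : ∃ k : ℤ, x = (k : ℝ) := by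
  have hcard : 0 < (B.card : ℝ) := by exact_mod_cast Finset.card_pos.2 ⟨0, h0⟩
  have hsum : ‖∑ b ∈ B, e (b : ℝ) x‖ = B.card := by
    rw [mask, norm_mul, norm_div, norm_one, Complex.norm_natCast] at hx
    field_simp at hx
    exact hx
  have h1' : (1 : ℤ) ∈ B.erase 0 := Finset.mem_erase.2 ⟨one_ne_zero, h1⟩
  rw [← Finset.add_sum_erase _ _ h0, ← Finset.add_sum_erase _ _ h1', ← add_assoc] at hsum
  have hrest : ‖∑ b ∈ (B.erase 0).erase 1, e (b : ℝ) x‖ ≤ (B.card : ℝ) - 2 := by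
    refine (norm_sum_le _ _).trans ?_
    simp only [norm_e, Finset.sum_const, nsmul_eq_mul, mul_one]
    have e1 := Finset.card_erase_add_one h1'
    have e0 := Finset.card_erase_add_one h0
    have : ((B.erase 0).erase 1).card + 2 = B.card := by omega
    have : (((B.erase 0).erase 1).card : ℝ) + 2 = B.card := by exact_mod_cast this
    linarith
  have htri := norm_add_le (e ((0 : ℤ) : ℝ) x + e ((1 : ℤ) : ℝ) x)
    (∑ b ∈ (B.erase 0).erase 1, e (b : ℝ) x)
  rw [hsum] at htri
  have hz : e ((0 : ℤ) : ℝ) x = 1 := by simp [e]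
  have hw := norm_e ((1 : ℤ) : ℝ) x
  rw [hz] at htri
  have h2 : (2 : ℝ) ≤ ‖1 + e ((1 : ℤ) : ℝ) x‖ := by linarith
  have hone : e ((1 : ℤ) : ℝ) x = 1 := by
    generalize e ((1 : ℤ) : ℝ) x = w at hw h2
    have a1 : w.re * w.re + w.im * w.im = 1 := by
      rw [← Complex.normSq_apply, Complex.normSq_eq_norm_sq, hw]; norm_num
    have a2 : (4 : ℝ) ≤ (1 + w.re) * (1 + w.re) + w.im * w.im := by
      have : Complex.normSq (1 + w) = (1 + w.re) * (1 + w.re) + w.im * w.im := by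
        simp [Complex.normSq_apply]
      rw [← this, Complex.normSq_eq_norm_sq]
      nlinarith
    have a3 : w.re = 1 := by nlinarith [mul_self_nonneg w.im]
    have a4 : w.im = 0 := by
      rw [a3] at a1
      exact mul_self_eq_zero.1 (by linarith)
    exact Complex.ext a3 a4
  obtain ⟨n, hn⟩ := Complex.exp_eq_one_iff.1 hone
  refine ⟨n, ?_⟩
  have hpi : (2 * (Real.pi : ℂ) * Complex.I) ≠ 0 := Complex.two_pi_I_ne_zero
  have : (2 * (Real.pi : ℂ) * Complex.I) * (x : ℂ) = (2 * (Real.pi : ℂ) * Complex.I) * (n : ℂ) := by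
    rw [mul_comm _ (n : ℂ), ← hn]; push_cast; ring
  exact_mod_cast mul_left_cancel₀ hpi this

theorem abs_le_of_mem_cycle {R : ℕ} (hR : 1 < R) {L : Finset ℤ} {M : ℝ}
    (hM : ∀ l ∈ L, |(l : ℝ)| ≤ M) {C : Set ℝ} (hC : IsCycle R L C) {y : ℝ} (hy : y ∈ C) :
    |y| ≤ M := by
  obtain ⟨p, x, l, hp, hstep, hclose, rfl⟩ := hC
  obtain ⟨i, hi, rfl⟩ := hy
  obtain ⟨j, hj, hmax⟩ := Finset.exists_max_image (Finset.range p) (fun i => |x i|)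
    ⟨0, Finset.mem_range.2 hp⟩
  have hR2 : (2 : ℝ) ≤ R := by exact_mod_cast hR
  have key : ∃ k < p, x (k + 1) = x j := by
    rcases j with _ | j
    · exact ⟨p - 1, by omega, by rw [Nat.sub_add_cancel hp, hclose]⟩
    · exact ⟨j, by have := Finset.mem_range.1 hj; omega, rfl⟩
  obtain ⟨k, hk, hkj⟩ := key
  obtain ⟨hl, hb⟩ := hstep k hk
  have hb' : (R : ℝ) * x j = x k + l k := by
    rw [← hkj, ← hb, branch]; field_simp
  have h1 : (R : ℝ) * |x j| ≤ |x k| + |(l k : ℝ)| := by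
    calc (R : ℝ) * |x j| = |(R : ℝ) * x j| := by rw [abs_mul, Nat.abs_cast]
      _ ≤ _ := by rw [hb']; exact abs_add_le _ _
  have h2 := hmax k (Finset.mem_range.2 hk)
  have h3 := hmax i (Finset.mem_range.2 hi)
  have h4 := hM _ hl
  have h5 : 2 * |x j| ≤ R * |x j| := mul_le_mul_of_nonneg_right hR2 (abs_nonneg _)
  linarith

/-- The sets `Λ_n` are finite, so the sums over them below are honest finite sums. -/
theorem freqSet_finite {R : ℕ} (hR : 1 < R) {B : Finset ℤ} (h0 : (0 : ℤ) ∈ B)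
    (h1 : (1 : ℤ) ∈ B) (L : Finset ℤ) (n : ℕ) : (freqSet R B L n).Finite := by
  induction n with
  | zero =>
    obtain ⟨M, hM⟩ : ∃ M : ℤ, ∀ l ∈ L, |l| ≤ M :=
      ⟨∑ l ∈ L, |l|, fun l hl => Finset.single_le_sum (fun i _ => abs_nonneg i) hl⟩
    refine ((Set.finite_Icc (-M) M).image (fun k : ℤ => (k : ℝ))).subset ?_
    rintro y ⟨C, ⟨hC, hext⟩, hy⟩
    obtain ⟨k, hk⟩ := exists_int_of_norm_mask h0 h1 (hext _ hy)
    have hb : |-y| ≤ (M : ℝ) :=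
      abs_le_of_mem_cycle hR (fun l hl => by exact_mod_cast hM l hl) hC hy
    rw [hk] at hb
    have hb' : |k| ≤ M := by exact_mod_cast hb
    obtain ⟨b1, b2⟩ := abs_le.1 hb'
    refine ⟨-k, ⟨by omega, by omega⟩, ?_⟩
    push_cast
    linarith
  | succ n ih =>
    refine (Set.Finite.image2 (fun (t : ℝ) (l : ℤ) => (R : ℝ) * t + (l : ℝ)) ih
      L.finite_toSet).subset ?_
    rintro y ⟨t, ht, l, hl, rfl⟩
    exact ⟨t, ht, l, hl, rfl⟩

/-- The digit set `{0, …, R - 1}`, whose invariant measure is Lebesgue measure on `[0, 1]`. -/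
noncomputable def digits (R : ℕ) : Finset ℤ := Finset.Ico 0 (R : ℤ)

/-- The sets `Λ_n` for `B = {0, …, R - 1}`. -/
def scrambledSet (R : ℕ) (L : Finset ℤ) (n : ℕ) : Set ℝ := freqSet R (digits R) L n

theorem scrambledSet_finite {R : ℕ} (hR : 1 < R) (L : Finset ℤ) (n : ℕ) :
    (scrambledSet R L n).Finite :=
  freqSet_finite hR (by simp [digits]; omega) (by simp [digits]; omega) L n

/-- The scrambled Dirichlet kernel `D_n(x) = ∑_{t ∈ Λ_n} exp(2πi t x)`. -/
noncomputable def dirichletKernel (R : ℕ) (L : Finset ℤ) (n : ℕ) (x : ℝ) : ℂ :=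
  ∑ᶠ t ∈ scrambledSet R L n, e t x

/-- The partial sums
`s_n(f; x) = ∑_{t ∈ Λ_n} (∫_0^1 f(y) exp(-2πi t y) dy) exp(2πi t x)`
of the scrambled Fourier series of `f`. -/
noncomputable def partialSum (R : ℕ) (L : Finset ℤ) (f : ℝ → ℂ) (n : ℕ) (x : ℝ) : ℂ :=
  ∑ᶠ t ∈ scrambledSet R L n, (∫ y in (0 : ℝ)..1, f y * e (-t) y) * e t x

/-- The Laurent polynomial `p_L(z) = ∑_{l ∈ L} z^l`. -/
noncomputable def digitPoly (L : Finset ℤ) : LaurentPolynomial ℂ := ∑ l ∈ L, T l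

/-- The value of a Laurent polynomial at `z ≠ 0`. -/
noncomputable def evalAt (p : LaurentPolynomial ℂ) (z : ℂ) : ℂ :=
  p.coeff.sum fun n a => a * z ^ n

/-- The Mahler measure `Δ(p) = exp (∫_0^1 log |p(exp(2πi x))| dx)`, with `Δ(0) = 0`. -/
noncomputable def mahlerMeasure (p : LaurentPolynomial ℂ) : ℝ :=
  open Classical in
  if p = 0 then 0 else Real.exp (∫ x in (0 : ℝ)..1, Real.log ‖evalAt p (e 1 x)‖)

end ScrambledFourier

namespace ScrambledFourier

open MeasureTheory Set

/-! The digits are distinct mod `R` and the frequencies are integers, so the kernels factor: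
`D_{n+1}(x) = D_n(Rx) p_L(e^{2πix})` (`dirichletKernel_succ`). Since `x ↦ Rx` preserves Lebesgue
measure on the circle, taking logarithms gives `∫ log|D_n| = ∫ log|D_0| + n log Δ(p_L)`. Jensen's
inequality for `exp` then yields `∫ |D_n| ≥ c Δ(p_L)^n` with `c = exp ∫ log|D_0| > 0`
(`mul_mahlerMeasure_pow_le`), which is (i).

For (ii), the functional `f ↦ s_n(f; 0)` on the continuous functions on the circle has norm at least
`∫ |D_n| - 1` (`integral_norm_dirichletKernel_le`). These norms are unbounded, so the uniform
boundedness principle provides `f`. -/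

theorem e_zero_right (t : ℝ) : e t 0 = 1 := by simp [e]

theorem e_add_left (s t x : ℝ) : e (s + t) x = e s x * e t x := by
  rw [e, e, e, ← Complex.exp_add]
  congr 1
  push_cast
  ring

theorem e_mul_left (s t x : ℝ) : e (s * t) x = e t (s * x) := by
  rw [e, e]
  congr 1
  push_cast
  ring

theorem e_one_zpow (l : ℤ) (x : ℝ) : e 1 x ^ l = e l x := by
  rw [e, e, ← Complex.exp_int_mul]
  congr 1
  push_cast
  ring

theorem e_neg_left (t x : ℝ) : e (-t) x = (starRingEnd ℂ) (e t x) := by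
  rw [e, e, ← Complex.exp_conj]
  congr 1
  simp [Complex.conj_ofNat]

theorem e_periodic (k : ℤ) : Function.Periodic (e k) 1 := by
  intro x
  rw [e, e, Complex.exp_eq_exp_iff_exists_int]
  exact ⟨k, by push_cast; ring⟩

theorem analyticAt_e (t x : ℝ) : AnalyticAt ℝ (e t) x := by
  have h : AnalyticAt ℝ (fun y : ℝ => 2 * (Real.pi : ℂ) * Complex.I * (t : ℂ) * (y : ℂ)) x :=
    analyticAt_const.mul (Complex.ofRealCLM.analyticAt x)
  exact AnalyticAt.fun_comp (g := Complex.exp) (analyticAt_cexp.restrictScalars) h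

theorem continuous_e (t : ℝ) : Continuous (e t) :=
  continuous_iff_continuousAt.2 fun x => (analyticAt_e t x).continuousAt

/-! ### Logarithmic integrals of analytic functions -/

section LogIntegral

variable {F : ℝ → ℂ}

theorem intervalIntegrable_log_norm_of_analytic (hF : ∀ x, AnalyticAt ℝ F x) (a b : ℝ) :
    IntervalIntegrable (fun x => Real.log ‖F x‖) volume a b :=
  MeromorphicOn.intervalIntegrable_log_norm fun x _ => (hF x).meromorphicAt

/-- A nonzero value at one point rules out `F = 0`, so the zeros are isolated and hence null. -/
theorem ae_ne_zero_of_analytic (hF : ∀ x, AnalyticAt ℝ F x) (h0 : F 0 ≠ 0) :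
    ∀ᵐ x : ℝ, F x ≠ 0 := by
  have h : F ⁻¹' {0}ᶜ ∈ codiscrete ℝ :=
    AnalyticOnNhd.preimage_zero_mem_codiscrete (fun x _ => hF x) h0
  have := ae_restrict_le_codiscreteWithin (μ := volume) MeasurableSet.univ h
  rw [Measure.restrict_univ] at this
  exact this

theorem integral_comp_nat_mul {g : ℝ → ℝ} (hg : Function.Periodic g 1) {R : ℕ} (hR : R ≠ 0)
    (hint : ∀ a b, IntervalIntegrable g volume a b) :
    ∫ x in (0 : ℝ)..1, g (R * x) = ∫ x in (0 : ℝ)..1, g x := by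
  have hR' : (R : ℝ) ≠ 0 := by exact_mod_cast hR
  rw [intervalIntegral.integral_comp_mul_left _ hR']
  have := hg.intervalIntegral_add_zsmul_eq R 0 hint
  simp only [zero_add, natCast_zsmul, nsmul_eq_mul, mul_one] at this
  rw [mul_zero, mul_one, this, smul_eq_mul]
  field_simp

/-- Jensen's inequality: the geometric mean is at most the arithmetic mean. -/
theorem exp_integral_log_norm_le (hF : ∀ x, AnalyticAt ℝ F x) (h0 : F 0 ≠ 0) :
    Real.exp (∫ x in (0 : ℝ)..1, Real.log ‖F x‖) ≤ ∫ x in (0 : ℝ)..1, ‖F x‖ := by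
  have hcont : Continuous F := continuous_iff_continuousAt.2 fun x => (hF x).continuousAt
  have hlog := (intervalIntegrable_iff_integrableOn_Ioc_of_le zero_le_one).1
    (intervalIntegrable_log_norm_of_analytic hF 0 1)
  have hnorm := (intervalIntegrable_iff_integrableOn_Ioc_of_le zero_le_one).1
    (hcont.norm.intervalIntegrable (μ := volume) 0 1)
  -- Only almost everywhere: at a zero of `F`, `Real.log 0 = 0` makes the left side `1`.
  have hae : (fun x => Real.exp (Real.log ‖F x‖)) =ᵐ[volume.restrict (Ioc 0 1)]
      fun x => ‖F x‖ := by
    filter_upwards [ae_restrict_of_ae (ae_ne_zero_of_analytic hF h0)] with x hx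
    exact Real.exp_log (norm_pos_iff.2 hx)
  have : IsProbabilityMeasure (volume.restrict (Ioc (0 : ℝ) 1)) := ⟨by simp⟩
  rw [intervalIntegral.integral_of_le zero_le_one, intervalIntegral.integral_of_le zero_le_one,
    ← integral_congr_ae hae]
  exact convexOn_exp.map_integral_le Real.continuous_exp.continuousOn isClosed_univ
    (by simp) hlog (hnorm.congr hae.symm)

end LogIntegral

/-! ### Factorization and growth of the Dirichlet kernels -/

section Frequencies

variable {R : ℕ} {L : Finset ℤ}

theorem exists_int_of_mem_scrambledSet (hR : 1 < R) (n : ℕ) {t : ℝ}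
    (ht : t ∈ scrambledSet R L n) : ∃ k : ℤ, t = k := by
  induction n generalizing t with
  | zero =>
    obtain ⟨C, ⟨-, hC⟩, hy⟩ := ht
    obtain ⟨k, hk⟩ := exists_int_of_norm_mask (by simp [digits]; omega) (by simp [digits]; omega)
      (hC _ hy)
    exact ⟨-k, by push_cast; linarith⟩
  | succ n ih =>
    obtain ⟨s, hs, l, -, rfl⟩ := ht
    obtain ⟨k, rfl⟩ := ih hs
    exact ⟨R * k + l, by push_cast; rfl⟩

/-- The digit `0` fixes the point `0`, where the mask equals `1`, so `{0}` is an extreme cycle. This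
makes `D_n(0)`, the number of frequencies, nonzero. -/
theorem zero_mem_scrambledSet (hR : 1 < R) (h0 : (0 : ℤ) ∈ L) (n : ℕ) :
    (0 : ℝ) ∈ scrambledSet R L n := by
  induction n with
  | zero =>
    refine ⟨{0}, ⟨⟨1, fun _ => 0, fun _ => 0, one_pos, ?_, rfl, ?_⟩, ?_⟩, by simp⟩
    · intro i _
      exact ⟨h0, by simp [branch]⟩
    · ext y
      simp [eq_comm]
    · rintro y rfl
      have : R ≠ 0 := by omega
      simp [mask, e_zero_right, digits, this]
  | succ n ih => exact ⟨0, ih, 0, h0, by simp⟩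

/-- The finite set `Λ_n`. -/
noncomputable def scrambledFinset (hR : 1 < R) (L : Finset ℤ) (n : ℕ) : Finset ℝ :=
  (scrambledSet_finite hR L n).toFinset

theorem mem_scrambledFinset (hR : 1 < R) {n : ℕ} {t : ℝ} :
    t ∈ scrambledFinset hR L n ↔ t ∈ scrambledSet R L n :=
  Set.Finite.mem_toFinset _

theorem dirichletKernel_eq_sum (hR : 1 < R) (n : ℕ) (x : ℝ) :
    dirichletKernel R L n x = ∑ t ∈ scrambledFinset hR L n, e t x :=
  finsum_mem_eq_finite_toFinset_sum _ _

theorem partialSum_eq_sum (hR : 1 < R) (f : ℝ → ℂ) (n : ℕ) (x : ℝ) :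
    partialSum R L f n x = ∑ t ∈ scrambledFinset hR L n,
      (∫ y in (0 : ℝ)..1, f y * e (-t) y) * e t x :=
  finsum_mem_eq_finite_toFinset_sum _ _

theorem dirichletKernel_zero_ne (hR : 1 < R) (h0 : (0 : ℤ) ∈ L) (n : ℕ) :
    dirichletKernel R L n 0 ≠ 0 := by
  rw [dirichletKernel_eq_sum hR]
  simp only [e_zero_right, Finset.sum_const, nsmul_eq_mul, mul_one, Nat.cast_ne_zero]
  exact Finset.card_ne_zero_of_mem
    ((mem_scrambledFinset hR).2 (zero_mem_scrambledSet hR h0 n))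

theorem analyticAt_dirichletKernel (hR : 1 < R) (n : ℕ) (x : ℝ) :
    AnalyticAt ℝ (dirichletKernel R L n) x := by
  rw [funext (dirichletKernel_eq_sum hR n)]
  exact Finset.analyticAt_fun_sum _ fun t _ => analyticAt_e t x

theorem continuous_dirichletKernel (hR : 1 < R) (n : ℕ) : Continuous (dirichletKernel R L n) :=
  continuous_iff_continuousAt.2 fun x => (analyticAt_dirichletKernel hR n x).continuousAt

theorem dirichletKernel_periodic (hR : 1 < R) (n : ℕ) :
    Function.Periodic (dirichletKernel R L n) 1 := by
  intro x
  rw [dirichletKernel_eq_sum hR, dirichletKernel_eq_sum hR]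
  refine Finset.sum_congr rfl fun t ht => ?_
  obtain ⟨k, rfl⟩ := exists_int_of_mem_scrambledSet hR n ((mem_scrambledFinset hR).1 ht)
  exact e_periodic k x

theorem dirichletKernel_succ (hR : 1 < R) (hL : IsCompleteResidueSystem R L) (n : ℕ) (x : ℝ) :
    dirichletKernel R L (n + 1) x = dirichletKernel R L n (R * x) * ∑ l ∈ L, e l x := by
  classical
  have himage : scrambledFinset hR L (n + 1) =
      (scrambledFinset hR L n ×ˢ L).image fun q : ℝ × ℤ => (R : ℝ) * q.1 + (q.2 : ℝ) := by
    ext y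
    simp only [mem_scrambledFinset, Finset.mem_image, Finset.mem_product, Prod.exists]
    constructor
    · rintro ⟨t, ht, l, hl, rfl⟩
      exact ⟨t, l, ⟨ht, hl⟩, rfl⟩
    · rintro ⟨t, l, ⟨ht, hl⟩, rfl⟩
      exact ⟨t, ht, l, hl, rfl⟩
  rw [dirichletKernel_eq_sum hR, dirichletKernel_eq_sum hR, himage, Finset.sum_image,
    Finset.sum_mul_sum, Finset.sum_product]
  · simp only [e_add_left, e_mul_left]
  -- Reducing mod `R` recovers the digit `l`, and then `t`; no frequency is counted twice.
  · rintro ⟨t, l⟩ h ⟨t', l'⟩ h' heq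
    simp only [Finset.coe_product, Set.mem_prod, Finset.mem_coe, mem_scrambledFinset] at h h'
    obtain ⟨k, rfl⟩ := exists_int_of_mem_scrambledSet hR n h.1
    obtain ⟨k', rfl⟩ := exists_int_of_mem_scrambledSet hR n h'.1
    have heq' : (R : ℤ) * k + l = R * k' + l' := by
      dsimp only at heq
      exact_mod_cast heq
    have hmod : l' ≡ l [ZMOD (R : ℤ)] := by
      rw [Int.modEq_iff_dvd]
      exact ⟨k' - k, by linarith⟩
    obtain rfl : l = l' := (hL l).unique ⟨h.2, Int.ModEq.refl l⟩ ⟨h'.2, hmod⟩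
    have hR0 : (R : ℤ) ≠ 0 := by omega
    obtain rfl : k = k' := mul_left_cancel₀ hR0 (by linarith)
    rfl

theorem evalAt_digitPoly (L : Finset ℤ) (x : ℝ) :
    evalAt (digitPoly L) (e 1 x) = ∑ l ∈ L, e l x := by
  classical
  rw [evalAt, digitPoly, AddMonoidAlgebra.coeff_sum,
    ← Finsupp.sum_finsetSum_index (by simp) (fun _ _ _ => add_mul _ _ _)]
  refine Finset.sum_congr rfl fun l _ => ?_
  rw [LaurentPolynomial.T, AddMonoidAlgebra.coeff_single, Finsupp.sum_single_index (by simp),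
    one_mul, e_one_zpow]

theorem sum_e_zero_ne (h0 : (0 : ℤ) ∈ L) : ∑ l ∈ L, e (l : ℝ) 0 ≠ 0 := by
  simp only [e_zero_right, Finset.sum_const, nsmul_eq_mul, mul_one, ne_eq, Nat.cast_eq_zero]
  exact Finset.card_ne_zero_of_mem h0

theorem mahlerMeasure_digitPoly (h0 : (0 : ℤ) ∈ L) :
    mahlerMeasure (digitPoly L) = Real.exp (∫ x in (0 : ℝ)..1, Real.log ‖∑ l ∈ L, e l x‖) := by
  -- The default value at the zero polynomial is excluded by `p_L(1) = #L ≠ 0`.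
  have hne : digitPoly L ≠ 0 := by
    intro h
    apply sum_e_zero_ne h0
    rw [← evalAt_digitPoly, h]
    simp [evalAt]
  rw [mahlerMeasure, if_neg hne]
  simp only [evalAt_digitPoly]

/-- Each use of the factorization adds one copy of `∫ log|p_L|`, because the rescaled kernel
`D_n(Rx)` has the same logarithmic mean as `D_n`. -/
theorem integral_log_norm_dirichletKernel (hR : 1 < R) (h0 : (0 : ℤ) ∈ L)
    (hL : IsCompleteResidueSystem R L) (n : ℕ) :
    ∫ x in (0 : ℝ)..1, Real.log ‖dirichletKernel R L n x‖ =
      (∫ x in (0 : ℝ)..1, Real.log ‖dirichletKernel R L 0 x‖) +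
        n * ∫ x in (0 : ℝ)..1, Real.log ‖∑ l ∈ L, e l x‖ := by
  induction n with
  | zero => simp
  | succ n ih =>
    have hP : ∀ x, AnalyticAt ℝ (fun y => ∑ l ∈ L, e (l : ℝ) y) x := fun x =>
      Finset.analyticAt_fun_sum _ fun l _ => analyticAt_e l x
    have hD : ∀ x, AnalyticAt ℝ (fun y => dirichletKernel R L n (R * y)) x := fun x =>
      (analyticAt_dirichletKernel hR n _).comp (analyticAt_const.mul analyticAt_id)
    have hae : ∀ᵐ x : ℝ, x ∈ uIoc (0 : ℝ) 1 → Real.log ‖dirichletKernel R L (n + 1) x‖ =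
        Real.log ‖dirichletKernel R L n (R * x)‖ + Real.log ‖∑ l ∈ L, e l x‖ := by
      filter_upwards [ae_ne_zero_of_analytic hP (sum_e_zero_ne h0),
        ae_ne_zero_of_analytic hD (by simpa using dirichletKernel_zero_ne hR h0 n)] with x h1 h2 _
      rw [dirichletKernel_succ hR hL, norm_mul,
        Real.log_mul (norm_ne_zero_iff.2 h2) (norm_ne_zero_iff.2 h1)]
    have hscale := integral_comp_nat_mul (R := R)
      (g := fun x => Real.log ‖dirichletKernel R L n x‖)
      (fun x => by simp only [dirichletKernel_periodic hR n x]) (by omega)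
      (intervalIntegrable_log_norm_of_analytic (analyticAt_dirichletKernel hR n))
    rw [intervalIntegral.integral_congr_ae hae, intervalIntegral.integral_add
      (intervalIntegrable_log_norm_of_analytic hD 0 1)
      (intervalIntegrable_log_norm_of_analytic hP 0 1), hscale, ih]
    push_cast
    ring

theorem mul_mahlerMeasure_pow_le (hR : 1 < R) (h0 : (0 : ℤ) ∈ L)
    (hL : IsCompleteResidueSystem R L) (n : ℕ) :
    Real.exp (∫ x in (0 : ℝ)..1, Real.log ‖dirichletKernel R L 0 x‖) *
      mahlerMeasure (digitPoly L) ^ n ≤ ∫ x in (0 : ℝ)..1, ‖dirichletKernel R L n x‖ := by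
  rw [mahlerMeasure_digitPoly h0, ← Real.exp_nat_mul, ← Real.exp_add,
    ← integral_log_norm_dirichletKernel hR h0 hL]
  exact exp_integral_log_norm_le (analyticAt_dirichletKernel hR n) (dirichletKernel_zero_ne hR h0 n)

end Frequencies

/-! ### Norms of the partial sum functionals -/

section Divergence

variable {R : ℕ} {L : Finset ℤ}

theorem partialSum_zero_eq (hR : 1 < R) {f : ℝ → ℂ} (hf : Continuous f) (n : ℕ) :
    partialSum R L f n 0 =
      ∫ y in (0 : ℝ)..1, f y * (starRingEnd ℂ) (dirichletKernel R L n y) := by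
  simp only [partialSum_eq_sum hR, dirichletKernel_eq_sum hR, e_zero_right, mul_one, map_sum,
    Finset.mul_sum, ← e_neg_left]
  exact (intervalIntegral.integral_finsetSum fun t _ =>
    (hf.mul (continuous_e _)).intervalIntegrable 0 1).symm

/-- The functional `f ↦ s_n(f; 0)` on the continuous functions on the circle. -/
noncomputable def partialSumCLM (hR : 1 < R) (L : Finset ℤ) (n : ℕ) :
    C(AddCircle (1 : ℝ), ℂ) →L[ℂ] ℂ :=
  LinearMap.mkContinuous
    { toFun := fun f =>
        ∫ y in (0 : ℝ)..1, f (y : AddCircle (1 : ℝ)) * (starRingEnd ℂ) (dirichletKernel R L n y)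
      map_add' := fun f g => by
        have hint : ∀ h : C(AddCircle (1 : ℝ), ℂ), IntervalIntegrable (fun y : ℝ =>
            h (y : AddCircle (1 : ℝ)) * (starRingEnd ℂ) (dirichletKernel R L n y))
            volume 0 1 := fun h =>
          ((h.continuous.comp (AddCircle.continuous_mk' 1)).mul
            (Complex.continuous_conj.comp (continuous_dirichletKernel hR n))).intervalIntegrable 0 1
        rw [← intervalIntegral.integral_add (hint f) (hint g)]
        simp only [ContinuousMap.add_apply, add_mul]
      map_smul' := fun c f => by
        simp only [ContinuousMap.smul_apply, smul_eq_mul, mul_assoc, RingHom.id_apply,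
          intervalIntegral.integral_const_mul] }
    (∫ y in (0 : ℝ)..1, ‖dirichletKernel R L n y‖) fun f => by
      rw [mul_comm, ← intervalIntegral.integral_const_mul]
      refine intervalIntegral.norm_integral_le_of_norm_le zero_le_one (ae_of_all _ fun y _ => ?_)
        ((continuous_const.mul (continuous_dirichletKernel hR n).norm).intervalIntegrable 0 1)
      rw [norm_mul, RCLike.norm_conj]
      exact mul_le_mul_of_nonneg_right (f.norm_coe_le_norm _) (norm_nonneg _)

theorem partialSumCLM_apply (hR : 1 < R) (n : ℕ) (f : C(AddCircle (1 : ℝ), ℂ)) :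
    partialSumCLM hR L n f =
      ∫ y in (0 : ℝ)..1, f (y : AddCircle (1 : ℝ)) * (starRingEnd ℂ) (dirichletKernel R L n y) :=
  rfl

/-- The natural test function `D/|D|` may be discontinuous at zeros of `D`. The continuous
substitute `D/(|D| + 1)` has norm at most `1`, and costs only an additive `1` since `|D|²/(|D| + 1)
≥ |D| - 1`. -/
theorem integral_norm_dirichletKernel_le (hR : 1 < R) (n : ℕ) :
    ∫ y in (0 : ℝ)..1, ‖dirichletKernel R L n y‖ ≤ ‖partialSumCLM hR L n‖ + 1 := by
  set D := dirichletKernel R L n with hD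
  have hDc : Continuous D := continuous_dirichletKernel hR n
  have hpos : ∀ y, 0 < ‖D y‖ + 1 := fun y => by positivity
  have hper : Function.Periodic (fun y => D y / ((‖D y‖ + 1 : ℝ) : ℂ)) 1 := fun y => by
    simp only [hD, dirichletKernel_periodic hR n y]
  have hgc : Continuous fun y => D y / ((‖D y‖ + 1 : ℝ) : ℂ) :=
    hDc.div (Complex.continuous_ofReal.comp (hDc.norm.add continuous_const)) fun y => by
      exact_mod_cast (hpos y).ne'
  let g : C(AddCircle (1 : ℝ), ℂ) := ⟨hper.lift, continuous_coinduced_dom.2 hgc⟩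
  have hg : ‖g‖ ≤ 1 := by
    refine (ContinuousMap.norm_le _ zero_le_one).2 fun x => ?_
    induction x using QuotientAddGroup.induction_on with
    | H y =>
      change ‖D y / ((‖D y‖ + 1 : ℝ) : ℂ)‖ ≤ 1
      rw [norm_div, Complex.norm_real, Real.norm_of_nonneg (hpos y).le, div_le_one (hpos y)]
      linarith
  have happ : partialSumCLM hR L n g =
      ((∫ y in (0 : ℝ)..1, ‖D y‖ ^ 2 / (‖D y‖ + 1) : ℝ) : ℂ) := by
    rw [partialSumCLM_apply, ← intervalIntegral.integral_ofReal]
    refine intervalIntegral.integral_congr fun y _ => ?_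
    change D y / ((‖D y‖ + 1 : ℝ) : ℂ) * (starRingEnd ℂ) (D y) = _
    rw [div_mul_eq_mul_div, Complex.mul_conj, Complex.normSq_eq_norm_sq]
    push_cast
    rfl
  have hle : ∫ y in (0 : ℝ)..1, (‖D y‖ - 1) ≤ ∫ y in (0 : ℝ)..1, ‖D y‖ ^ 2 / (‖D y‖ + 1) := by
    refine intervalIntegral.integral_mono_on zero_le_one
      ((hDc.norm.sub continuous_const).intervalIntegrable 0 1)
      (((hDc.norm.pow 2).div (hDc.norm.add continuous_const)
        fun y => (hpos y).ne').intervalIntegrable 0 1) fun y _ => ?_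
    rw [le_div_iff₀ (hpos y)]
    nlinarith
  rw [intervalIntegral.integral_sub (hDc.norm.intervalIntegrable 0 1)
    (continuous_const.intervalIntegrable 0 1)] at hle
  simp only [intervalIntegral.integral_const, sub_zero, smul_eq_mul, mul_one] at hle
  have hop := (partialSumCLM hR L n).le_opNorm_of_le hg
  rw [happ, Complex.norm_real, mul_one] at hop
  linarith [Real.le_norm_self (∫ y in (0 : ℝ)..1, ‖D y‖ ^ 2 / (‖D y‖ + 1))]

end Divergence

end ScrambledFourier

theorem corollary4p7 (R : ℕ) (hR : 1 < R) (L : Finset ℤ) (h0 : (0 : ℤ) ∈ L)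
    (hL : ScrambledFourier.IsCompleteResidueSystem R L)
    (hΔ : 1 < ScrambledFourier.mahlerMeasure (ScrambledFourier.digitPoly L)) :
    (∀ ρ : ℝ, 1 < ρ → ρ < ScrambledFourier.mahlerMeasure (ScrambledFourier.digitPoly L) →
      ∃ C : ℝ, 0 < C ∧ ∀ᶠ n : ℕ in atTop,
        C * ρ ^ n ≤ ∫ x in (0 : ℝ)..1, ‖ScrambledFourier.dirichletKernel R L n x‖) ∧
    (∃ f : ℝ → ℂ, Continuous f ∧ Function.Periodic f 1 ∧
      ¬ ∃ M : ℝ, ∀ n : ℕ, ‖ScrambledFourier.partialSum R L f n 0‖ ≤ M) := by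
  have hpos : 0 < Real.exp (∫ x in (0 : ℝ)..1,
      Real.log ‖ScrambledFourier.dirichletKernel R L 0 x‖) := Real.exp_pos _
  have hbound := ScrambledFourier.mul_mahlerMeasure_pow_le hR h0 hL
  -- The constant `exp ∫ log|D_0|` serves every `ρ` and every `n`.
  refine ⟨fun ρ h1 h2 => ⟨_, hpos, Eventually.of_forall fun n => ?_⟩, ?_⟩
  · exact (mul_le_mul_of_nonneg_left (pow_le_pow_left₀ (by linarith) h2.le n) hpos.le).trans
      (hbound n)
  · by_contra! hcon
    obtain ⟨M, hM⟩ := banach_steinhaus (g := ScrambledFourier.partialSumCLM hR L) fun f => by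
      have hf : Continuous fun y : ℝ => f (y : AddCircle (1 : ℝ)) :=
        f.continuous.comp (AddCircle.continuous_mk' 1)
      obtain ⟨M, hM⟩ := hcon _ hf fun y => by
        simp only [AddCircle.coe_add_period]
      refine ⟨M, fun n => ?_⟩
      rw [ScrambledFourier.partialSumCLM_apply, ← ScrambledFourier.partialSum_zero_eq hR hf]
      exact hM n
    -- `M` bounds all the operator norms; exceeding `M + 1` absorbs the additive loss in comparing
    -- them with `∫ |D_n|`.
    obtain ⟨n, hn⟩ := (((tendsto_pow_atTop_atTop_of_one_lt hΔ).const_mul_atTop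
      hpos).eventually_gt_atTop (M + 1)).exists
    linarith [hbound n, hM n, ScrambledFourier.integral_norm_dirichletKernel_le (L := L) hR n]
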